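/- Let $\mathfrak H$ be a separable, infinite dimensional complex Hilbert space and let $\psi\in\mathfrak H$ be a unit vector; inner products are linear in the first variable. Write $\mathcal P(\mathfrak H)$ for the set of (orthogonal) projections in $\mathcal B(\mathfrak H)$, $\mathcal K(\mathfrak H)$ for the compact operators, $\mathfrak H\otimes_{alg}\mathfrak H$ for the algebraic tensor product and $\mathfrak H\otimes\mathfrak H$ for the Hilbert space tensor product. For $x,y\in\mathcal B(\mathfrak H)$ let $x\otimes y\in\mathcal B(\mathfrak H\otimes\mathfrak H)$ be the bounded operator with $(x\otimes y)(h\otimes f)=xh\otimes yf$, and let $\mathcal K(\mathfrak H)\bullet\mathcal K(\mathfrak H)\subseteq\mathcal B(\mathfrak H\otimes\mathfrak H)$ be the space of finite sums of operators $x\otimes y$ with $x,y\in\mathcal K(\mathfrak H)$, with the operator norm. A decoherence functional is a function $d:\mathcal P(\mathfrak H)\times\mathcal P(\mathfrak H)\to\mathbb C$ such that $d(p,q)=\overline{d(q,p)}$, $d(p,p)\ge 0$, $d(1,1)=1$, and $d(p_1+p_2,q)=d(p_1,q)+d(p_2,q)$ whenever $p_1\perp p_2$. It is countably additive if $d(\sum_{i}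 p_i,q)=\sum_{i} d(p_i,q)$, with absolute convergence, for every sequence $(p_i)$ of pairwise orthogonal projections (the sum $\sum_i p_i$ being taken in the strong operator topology) and every projection $q$, and bounded if $\sup_{p,q}|d(p,q)|<\infty$. A linear functional $\beta$ on $\mathcal K(\mathfrak H)\bullet\mathcal K(\mathfrak H)$ is associated with $d$ if there is a bounded bilinear form $D$ on $\mathcal B(\mathfrak H)\times\mathcal B(\mathfrak H)$ extending $d$ such that $\beta(x\otimes y)=D(x,y)$ for all $x,y\in\mathcal K(\mathfrak H)$. For $\xi\in\mathfrak H\otimes_{alg}\mathfrak H$ with $\|\xi\|=1$ let $p_\xi\eta=\langle\eta,\xi\rangle\xi$; then $p_\xi\in\mathcal K(\mathfrak H)\bullet\mathcal K(\mathfrak H)$. The functional $d$ is tracially bounded if it is bounded and, for its associated functional $\beta$, there is a constant $C$ with $|\beta(p_\xi)|\le C$ for every unit vector $\xi\in\mathfrak H\otimes_{alg}\mathfrak H$. It is ILS-representable if there is a trace class operator $X$ on $\mathfrak H\otimes\mathfrak H$ with $d(p,q)=\mathrm{tr}((p\otimes q)X)$ for all $p,q\in\mathcal P(\mathfrak H)$.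 Let $B_\psi(x,y)=\langle x\psi,y^*\psi\rangle$, a bounded bilinear form on $\mathcal B(\mathfrak H)\times\mathcal B(\mathfrak H)$, and let $d_\psi(p,q)=\langle p\psi,q\psi\rangle$ for $p,q\in\mathcal P(\mathfrak H)$. Then: 1. $d_\psi$ is a bounded, countably additive decoherence functional, and it is the restriction of $B_\psi$ to pairs of projections. 2. $d_\psi$ is not ILS-representable. 3. There is exactly one linear functional $\beta_\psi$ on $\mathcal K(\mathfrak H)\bullet\mathcal K(\mathfrak H)$ associated with $d_\psi$; it satisfies $\beta_\psi(x\otimes y)=B_\psi(x,y)$ for all $x,y\in\mathcal K(\mathfrak H)$, and it is not bounded. 4. $d_\psi$ is tracially bounded. -/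

import Mathlib

open scoped TensorProduct

noncomputable section

namespace DecoherenceFunctional

/-! Mathlib's inner product `inner ℂ x y` is conjugate linear in the first variable, so that
`⟨x, y⟩`, taken linear in the first variable, reads `inner ℂ y x` below. -/

section TraceClass

variable {V : Type*} [NormedAddCommGroup V] [InnerProductSpace ℂ V] [CompleteSpace V]

/-- `T` is of trace class: `∑ ⟨|T| e, e⟩ < ∞` over an orthonormal basis, where
`|T| = (T* T)^(1/2)`. -/
def IsTraceClass (T : V →L[ℂ] V) : Prop :=
  ∃ (w : Set V) (b : HilbertBasis w ℂ V),
    Summable fun i => (inner ℂ (b i) (CFC.abs T (b i))).re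

variable (V) in
/-- The index set of an orthonormal basis of `V`. -/
def basisIndex : Set V := (exists_hilbertBasis ℂ V).choose

variable (V) in
/-- An orthonormal basis of `V`. -/
def hilbertBasis : HilbertBasis (basisIndex V) ℂ V :=
  (exists_hilbertBasis ℂ V).choose_spec.choose

/-- The trace `∑ ⟨T e, e⟩` of a trace class operator, over an orthonormal basis. -/
def trace (T : V →L[ℂ] V) : ℂ :=
  ∑' i, inner ℂ (hilbertBasis V i) (T (hilbertBasis V i))

end TraceClass

section Basic

variable (H : Type*) [NormedAddCommGroup H] [InnerProductSpace ℂ H]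

/-- The Hilbert space tensor product: the completion of the algebraic tensor product with the
inner product `⟨h₁ ⊗ f₁, h₂ ⊗ f₂⟩ = ⟨h₁, h₂⟩ ⟨f₁, f₂⟩`. -/
abbrev HilbertTensor : Type _ := UniformSpace.Completion (H ⊗[ℂ] H)

variable {H}

/-- The bounded operator `x ⊗ y` on the Hilbert space tensor product, the one with
`(x ⊗ y) (h ⊗ f) = x h ⊗ y f`. -/
def opTensor (x y : H →L[ℂ] H) : HilbertTensor H →L[ℂ] HilbertTensor H :=
  (TensorProduct.mapL x y).completion

theorem opTensor_tmul (x y : H →L[ℂ] H) (h f : H) :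
    opTensor x y ((h ⊗ₜ[ℂ] f : H ⊗[ℂ] H) : HilbertTensor H) =
      ((x h ⊗ₜ[ℂ] y f : H ⊗[ℂ] H) : HilbertTensor H) := by
  simp [opTensor]

variable (H) in
/-- The algebraic tensor product `K(H) • K(H)`: the finite sums of operators `x ⊗ y` on the
Hilbert space tensor product, with `x` and `y` compact. It carries the operator norm. -/
def compactTensor : Submodule ℂ (HilbertTensor H →L[ℂ] HilbertTensor H) :=
  Submodule.span ℂ
    {T | ∃ x y : H →L[ℂ] H, IsCompactOperator x ∧ IsCompactOperator y ∧ T = opTensor x y}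

theorem opTensor_mem {x y : H →L[ℂ] H} (hx : IsCompactOperator x) (hy : IsCompactOperator y) :
    opTensor x y ∈ compactTensor H :=
  Submodule.subset_span ⟨x, y, hx, hy, rfl⟩

/-- The operator `p_ξ : η ↦ ⟨η, ξ⟩ ξ` on the Hilbert space tensor product, for `ξ` in the
algebraic tensor product. For a unit vector it is the projection onto the line spanned by `ξ`. -/
def lineProj (ξ : H ⊗[ℂ] H) : HilbertTensor H →L[ℂ] HilbertTensor H :=
  InnerProductSpace.rankOne ℂ (ξ : HilbertTensor H) (ξ : HilbertTensor H)

theorem lineProj_apply (ξ : H ⊗[ℂ] H) (η : HilbertTensor H) :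
    lineProj ξ η = (inner ℂ (ξ : HilbertTensor H) η) • (ξ : HilbertTensor H) := rfl

theorem isCompactOperator_rankOne (a b : H) :
    IsCompactOperator (InnerProductSpace.rankOne ℂ a b) := by
  have h : IsCompactOperator (ContinuousLinearMap.toSpanSingleton ℂ a) :=
    (isCompactOperator_id (E := ℂ)).clm_comp (ContinuousLinearMap.toSpanSingleton ℂ a)
  rw [InnerProductSpace.rankOne_def']
  exact h.comp_clm (innerSL ℂ b)

theorem rankOne_mem (ξ η : H ⊗[ℂ] H) :
    InnerProductSpace.rankOne ℂ (ξ : HilbertTensor H) (η : HilbertTensor H) ∈ compactTensor H := by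
  induction ξ with
  | zero =>
    rw [UniformSpace.Completion.coe_zero, map_zero]
    exact Submodule.zero_mem _
  | add s t hs ht =>
    rw [UniformSpace.Completion.coe_add, map_add]
    exact Submodule.add_mem _ hs ht
  | tmul a b =>
    induction η with
    | zero =>
      rw [UniformSpace.Completion.coe_zero, map_zero]
      exact Submodule.zero_mem _
    | add s t hs ht =>
      rw [UniformSpace.Completion.coe_add, map_add]
      exact Submodule.add_mem _ hs ht
    | tmul c d =>
      have key : InnerProductSpace.rankOne ℂ ((a ⊗ₜ[ℂ] b : H ⊗[ℂ] H) : HilbertTensor H)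
          ((c ⊗ₜ[ℂ] d : H ⊗[ℂ] H) : HilbertTensor H) =
          opTensor (InnerProductSpace.rankOne ℂ a c) (InnerProductSpace.rankOne ℂ b d) := by
        ext z
        induction z using UniformSpace.Completion.induction_on with
        | hp => exact isClosed_eq (by fun_prop) (by fun_prop)
        | ih z =>
          induction z with
          | zero => rw [UniformSpace.Completion.coe_zero, map_zero, map_zero]
          | add s t hs ht =>
            rw [UniformSpace.Completion.coe_add, map_add, map_add, hs, ht]
          | tmul u v =>
            rw [opTensor_tmul, InnerProductSpace.rankOne_apply,
              UniformSpace.Completion.inner_coe, TensorProduct.inner_tmul,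
              InnerProductSpace.rankOne_apply, InnerProductSpace.rankOne_apply,
              TensorProduct.smul_tmul_smul, ← UniformSpace.Completion.coe_smul]
      rw [key]
      exact opTensor_mem (isCompactOperator_rankOne a c) (isCompactOperator_rankOne b d)

theorem lineProj_mem (ξ : H ⊗[ℂ] H) : lineProj ξ ∈ compactTensor H := rankOne_mem ξ ξ

/-- `β` is bounded on `K(H) • K(H)` for the operator norm. -/
def IsBoundedFunctional (β : compactTensor H →ₗ[ℂ] ℂ) : Prop :=
  ∃ C : ℝ, ∀ S : compactTensor H, ‖β S‖ ≤ C * ‖(S : HilbertTensor H →L[ℂ] HilbertTensor H)‖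

end Basic

section Decoherence

variable (H : Type*) [NormedAddCommGroup H] [InnerProductSpace ℂ H] [CompleteSpace H]

/-- The set of (orthogonal) projections in `B(H)`. -/
abbrev Proj : Type _ := {p : H →L[ℂ] H // IsStarProjection p}

variable {H}

/-- The identity, as a projection. -/
def Proj.id : Proj H := ⟨1, .one _⟩

/-- Decoherence functionals on the projections of `H`. -/
structure IsDecoherenceFunctional (d : Proj H → Proj H → ℂ) : Prop where
  hermitian : ∀ p q, d p q = starRingEnd ℂ (d q p)
  nonneg : ∀ p, 0 ≤ (d p p).re ∧ (d p p).im = 0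
  normalised : d Proj.id Proj.id = 1
  orthoadditive : ∀ p₁ p₂ p q : Proj H, p₁.1 * p₂.1 = 0 → p.1 = p₁.1 + p₂.1 →
    d p q = d p₁ q + d p₂ q

/-- Countable additivity. The sum of the pairwise orthogonal projections `p i` is their sum in
the strong operator topology; the series of complex numbers converges absolutely. -/
def IsCountablyAdditive (d : Proj H → Proj H → ℂ) : Prop :=
  ∀ (p : ℕ → Proj H) (s q : Proj H), (∀ i j, i ≠ j → (p i).1 * (p j).1 = 0) →
    (∀ x : H, HasSum (fun i => (p i).1 x) (s.1 x)) → HasSum (fun i => d (p i) q) (d s q)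

/-- `d` is bounded. -/
def IsBounded (d : Proj H → Proj H → ℂ) : Prop := ∃ C : ℝ, ∀ p q, ‖d p q‖ ≤ C

/-- `β` is the linear functional on `K(H) • K(H)` associated with `d`: it satisfies
`β (x ⊗ y) = D (x, y)` for all compact `x` and `y`, where `D` is a bounded bilinear form on
`B(H) × B(H)` that extends `d`. -/
def IsAssociated (d : Proj H → Proj H → ℂ) (β : compactTensor H →ₗ[ℂ] ℂ) : Prop :=
  ∃ D : (H →L[ℂ] H) →L[ℂ] (H →L[ℂ] H) →L[ℂ] ℂ, (∀ p q : Proj H, D p.1 q.1 = d p q) ∧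
    ∀ (x y : H →L[ℂ] H) (hx : IsCompactOperator x) (hy : IsCompactOperator y),
      β ⟨opTensor x y, opTensor_mem hx hy⟩ = D x y

/-- `d` is tracially bounded: it is bounded, and the associated functional is bounded on the
projections `p_ξ`, for the unit vectors `ξ` of the algebraic tensor product. -/
def IsTraciallyBounded (d : Proj H → Proj H → ℂ) : Prop :=
  IsBounded d ∧ ∃ β : compactTensor H →ₗ[ℂ] ℂ, IsAssociated d β ∧
    ∃ C : ℝ, ∀ ξ : H ⊗[ℂ] H, ‖ξ‖ = 1 → ‖β ⟨lineProj ξ, lineProj_mem ξ⟩‖ ≤ C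

/-- `d` is ILS-representable: `d (p, q) = tr ((p ⊗ q) X)` for a trace class operator `X`. -/
def IsILSRepresentable (d : Proj H → Proj H → ℂ) : Prop :=
  ∃ X : HilbertTensor H →L[ℂ] HilbertTensor H, IsTraceClass X ∧
    ∀ p q : Proj H, d p q = trace (opTensor p.1 q.1 * X)

/-- The bounded bilinear form `B_ψ (x, y) = ⟨x ψ, y* ψ⟩`. -/
def bilin (ψ : H) : (H →L[ℂ] H) →L[ℂ] (H →L[ℂ] H) →L[ℂ] ℂ :=
  LinearMap.mkContinuous₂
    (LinearMap.mk₂ ℂ (fun x y : H →L[ℂ] H => inner ℂ (ContinuousLinearMap.adjoint y ψ) (x ψ))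
      (by intros; simp) (by intros; simp)
      (by intros; simp)
      (by intros; simp [ContinuousLinearMap.adjoint_inner_left, inner_smul_right]))
    (‖ψ‖ * ‖ψ‖) (by
      intro x y
      have h1 : ‖ContinuousLinearMap.adjoint y ψ‖ ≤ ‖y‖ * ‖ψ‖ := by
        have := (ContinuousLinearMap.adjoint y).le_opNorm ψ
        rwa [LinearIsometryEquiv.norm_map] at this
      calc ‖inner ℂ (ContinuousLinearMap.adjoint y ψ) (x ψ)‖
          ≤ ‖ContinuousLinearMap.adjoint y ψ‖ * ‖x ψ‖ := norm_inner_le_norm _ _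
        _ ≤ (‖y‖ * ‖ψ‖) * (‖x‖ * ‖ψ‖) := by
            gcongr
            exact x.le_opNorm ψ
        _ = ‖ψ‖ * ‖ψ‖ * ‖x‖ * ‖y‖ := by ring)

theorem bilin_apply (ψ : H) (x y : H →L[ℂ] H) :
    bilin ψ x y = inner ℂ (ContinuousLinearMap.adjoint y ψ) (x ψ) := rfl

/-- The decoherence functional `d_ψ (p, q) = ⟨p ψ, q ψ⟩`. -/
def vectorFunctional (ψ : H) (p q : Proj H) : ℂ := inner ℂ (q.1 ψ) (p.1 ψ)

end Decoherence

end DecoherenceFunctional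

end

/-!
Everything rests on one computation. With `e` an orthonormal basis of `H`, expanding in `e` gives
`B_ψ (x, y) = ⟨x ψ, y* ψ⟩ = ∑ ⟨x ψ, e k⟩ ⟨e k, y* ψ⟩`, and the `k`-th term is a matrix coefficient
of the operator `x ⊗ y` between `ψ ⊗ e k` and `e k ⊗ ψ`. Hence
`contraction ψ : S ↦ ∑ ⟨S (ψ ⊗ e k), e k ⊗ ψ⟩` is a well defined linear functional on
`K(H) • K(H)` whose value at `x ⊗ y` is `B_ψ (x, y)` (`contraction_opTensor`), associated with
`d_ψ`. In comments, `⟨x, y⟩` is linear in the first variable.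

*Uniqueness.* By polarization rank one operators are combinations of projections, and compact
operators are norm limits of finite rank ones. So a bounded bilinear form extending `d_ψ` equals
`B_ψ` on compact operators (`eq_of_forall_proj_eq`).

*Tracial boundedness.* For a unit vector `ξ` the value at `p_ξ` is
`∑ ⟨ξ, e k ⊗ ψ⟩ ⟨ψ ⊗ e k, ξ⟩`; both families are orthonormal, so Cauchy–Schwarz and Bessel bound
it by `1` (`norm_contraction_lineProj_le`).

*Unboundedness.* The operator `∑_{k ≤ n} ⟨·, ψ ⊗ e k⟩ (e k ⊗ ψ)` is a partial isometry in
`K(H) • K(H)`, and any functional that agrees with `B_ψ` on rank one operators has the value `n` on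
it (`exists_large_of_eq_bilin`).

*No ILS representation.* For a trace class operator `X` the functional `S ↦ tr (S X)` is bounded
(`IsTraceClass.summable_and_exists_norm_trace_mul_le`). If it represents `d_ψ` on projections, it
agrees with `B_ψ` on rank one operators, which contradicts the unboundedness above. The trace bound
is proved by writing `X = U (|X| + ε)` with a contraction `U` and applying Cauchy–Schwarz to the
Hilbert–Schmidt operator `|X|^(1/2)`.
-/

namespace DecoherenceFunctional

/-! ### Trace class operators have bounded trace functionals -/

section TraceBound

variable {V : Type*} [NormedAddCommGroup V] [InnerProductSpace ℂ V] [CompleteSpace V]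

/-- A self-adjoint Hilbert–Schmidt operator `R` stays Hilbert–Schmidt after composition with a
bounded operator, and its Hilbert–Schmidt norm may be tested on any orthonormal family. By Parseval
the left side is a double sum of `|⟨R S (e i), b j⟩|²`; Bessel's inequality for `e` bounds it. -/
theorem sum_norm_sq_comp_le {κ ι : Type*} (b : HilbertBasis κ ℂ V) {R : V →L[ℂ] V}
    (hR : IsSelfAdjoint R) (hs : Summable fun j => ‖R (b j)‖ ^ 2) (S : V →L[ℂ] V) {e : ι → V}
    (he : Orthonormal ℂ e) (F : Finset ι) :
    ∑ i ∈ F, ‖R (S (e i))‖ ^ 2 ≤ ‖S‖ ^ 2 * ∑' j, ‖R (b j)‖ ^ 2 := by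
  have parseval (v : V) : HasSum (fun j => ‖inner ℂ (b j) v‖ ^ 2) (‖v‖ ^ 2) := by
    have h := Complex.hasSum_re (b.hasSum_inner_mul_inner v v)
    rw [inner_self_eq_norm_sq_to_K] at h
    convert! h using 1
    · ext j
      rw [← inner_conj_symm v (b j), ← Complex.normSq_eq_conj_mul_self, Complex.ofReal_re,
        Complex.normSq_eq_norm_sq]
    · norm_cast
  have h1 := hasSum_sum (s := F) fun i _ => parseval (R (S (e i)))
  rw [← h1.tsum_eq, ← tsum_mul_left]
  refine h1.summable.tsum_le_tsum (fun j => ?_) (hs.mul_left _)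
  calc ∑ i ∈ F, ‖inner ℂ (b j) (R (S (e i)))‖ ^ 2
      = ∑ i ∈ F, ‖inner ℂ (e i) (S.adjoint (R (b j)))‖ ^ 2 := by
        refine Finset.sum_congr rfl fun i _ => ?_
        rw [ContinuousLinearMap.adjoint_inner_right, norm_inner_symm,
          ← ContinuousLinearMap.adjoint_inner_left, hR.adjoint_eq, norm_inner_symm,
          norm_inner_symm]
    _ ≤ ‖S.adjoint (R (b j))‖ ^ 2 := he.sum_inner_products_le _
    _ ≤ (‖S.adjoint‖ * ‖R (b j)‖) ^ 2 := by
        gcongr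
        exact S.adjoint.le_opNorm _
    _ = ‖S‖ ^ 2 * ‖R (b j)‖ ^ 2 := by rw [LinearIsometryEquiv.norm_map, mul_pow]

theorem norm_abs_apply (X : V →L[ℂ] V) (v : V) : ‖CFC.abs X v‖ = ‖X v‖ := by
  have hsa : IsSelfAdjoint (CFC.abs X) := (CFC.abs_nonneg X).isSelfAdjoint
  have h : inner ℂ (CFC.abs X v) (CFC.abs X v) = inner ℂ (X v) (X v) := by
    have h1 : CFC.abs X (CFC.abs X v) = X.adjoint (X v) := by
      have := congrArg (fun T : V →L[ℂ] V => T v) (CFC.abs_mul_abs X)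
      simpa [ContinuousLinearMap.star_eq_adjoint] using this
    rw [← ContinuousLinearMap.adjoint_inner_right, hsa.adjoint_eq, h1,
      ContinuousLinearMap.adjoint_inner_right]
  rw [inner_self_eq_norm_sq_to_K, inner_self_eq_norm_sq_to_K] at h
  have h2 : ‖CFC.abs X v‖ ^ 2 = ‖X v‖ ^ 2 := by exact_mod_cast h
  exact (sq_eq_sq₀ (norm_nonneg _) (norm_nonneg _)).1 h2

/-- An approximate polar decomposition `X = U (|X| + ε)` with `U` a contraction, which avoids the
partial isometry of the exact one: `|X| + ε` is invertible and `‖X v‖ = ‖|X| v‖ ≤ ‖(|X| + ε) v‖`. -/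
theorem exists_eq_mul_abs_add (X : V →L[ℂ] V) {ε : ℝ} (hε : 0 < ε) :
    ∃ U : V →L[ℂ] V, ‖U‖ ≤ 1 ∧ ∀ v, X v = U (CFC.abs X v) + (ε : ℂ) • U v := by
  have hpos : (CFC.abs X).IsPositive :=
    (ContinuousLinearMap.nonneg_iff_isPositive _).1 (CFC.abs_nonneg X)
  set A := CFC.abs X with hA
  have hsq (v : V) : ‖(A + (ε : ℂ) • (1 : V →L[ℂ] V)) v‖ ^ 2 =
      ‖A v‖ ^ 2 + 2 * (ε * (inner ℂ (A v) v).re) + ε ^ 2 * ‖v‖ ^ 2 := by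
    rw [add_apply, smul_apply,
      one_apply_eq_self, norm_add_sq (𝕜 := ℂ), inner_smul_right, norm_smul]
    simp [mul_pow]
  have hunit : IsUnit (A + (ε : ℂ) • (1 : V →L[ℂ] V)) := by
    refine ContinuousLinearMap.isUnit_of_forall_le_norm_inner_map _ (c := ⟨ε, hε.le⟩) hε
      fun x => ?_
    calc ‖x‖ ^ 2 * ε ≤ (inner ℂ ((A + (ε : ℂ) • (1 : V →L[ℂ] V)) x) x).re := by
          have h0 : 0 ≤ (inner ℂ (A x) x).re := hpos.re_inner_nonneg_left x
          have h1 : (inner ℂ x x).re = ‖x‖ ^ 2 := inner_self_eq_norm_sq (𝕜 := ℂ) x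
          rw [add_apply, smul_apply, one_apply_eq_self, inner_add_left, inner_smul_left,
            Complex.conj_ofReal, Complex.add_re, Complex.re_ofReal_mul, h1]
          linarith
      _ ≤ _ := Complex.re_le_norm _
  obtain ⟨G, hG⟩ := hunit
  have hleft (v : V) : (↑G⁻¹ : V →L[ℂ] V) ((G : V →L[ℂ] V) v) = v := by
    rw [← mul_apply_eq_comp, Units.inv_mul, one_apply_eq_self]
  have hright (v : V) : (G : V →L[ℂ] V) ((↑G⁻¹ : V →L[ℂ] V) v) = v := by
    rw [← mul_apply_eq_comp, Units.mul_inv, one_apply_eq_self]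
  refine ⟨X * (↑G⁻¹ : V →L[ℂ] V), ?_, fun v => ?_⟩
  · refine ContinuousLinearMap.opNorm_le_bound _ zero_le_one fun v => ?_
    set w := (↑G⁻¹ : V →L[ℂ] V) v with hw
    have hv : v = (A + (ε : ℂ) • (1 : V →L[ℂ] V)) w := by rw [← hG, hw, hright]
    rw [mul_apply_eq_comp, ← hw, one_mul, ← norm_abs_apply, ← hA]
    refine (sq_le_sq₀ (norm_nonneg _) (norm_nonneg _)).1 ?_
    have h0 : 0 ≤ (inner ℂ (A w) w).re := hpos.re_inner_nonneg_left w
    rw [hv, hsq]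
    have : 0 ≤ 2 * (ε * (inner ℂ (A w) w).re) + ε ^ 2 * ‖w‖ ^ 2 := by positivity
    linarith
  · rw [← map_smul, ← map_add, mul_apply_eq_comp]
    have : A v + (ε : ℂ) • v = (G : V →L[ℂ] V) v := by rw [hG]; rfl
    rw [this, hleft]

/-- Trace class is defined through one orthonormal basis; this bound holds for every orthonormal
family. With `R = |X|^(1/2)` and `X = U (R R + ε)`, each term is at most
`‖R (T U)* e‖ ‖R e‖` up to `ε ‖T‖`, and Cauchy–Schwarz applies. -/
theorem IsTraceClass.exists_sum_norm_inner_le {X : V →L[ℂ] V} (hX : IsTraceClass X)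
    {ι : Type*} {e : ι → V} (he : Orthonormal ℂ e) :
    ∃ C : ℝ, ∀ (T : V →L[ℂ] V) (F : Finset ι),
      ∑ i ∈ F, ‖inner ℂ (e i) ((T * X) (e i))‖ ≤ ‖T‖ * C := by
  obtain ⟨w, b, hb⟩ := hX
  set A := CFC.abs X with hA
  set R := CFC.sqrt A with hR
  have hRsa : IsSelfAdjoint R := (CFC.sqrt_nonneg A).isSelfAdjoint
  have hRR (v : V) : R (R v) = A v := by
    rw [← mul_apply_eq_comp, hR, CFC.sqrt_mul_sqrt_self A (CFC.abs_nonneg X)]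
  have hRb (j : w) : ‖R (b j)‖ ^ 2 = (inner ℂ (b j) (A (b j))).re := by
    rw [← hRR, ← ContinuousLinearMap.adjoint_inner_left, hRsa.adjoint_eq,
      inner_self_eq_norm_sq_to_K]
    norm_cast
  have hs : Summable fun j => ‖R (b j)‖ ^ 2 := by simpa only [hRb] using hb
  set C := ∑' j, ‖R (b j)‖ ^ 2 with hC
  have hC0 : 0 ≤ C := tsum_nonneg fun j => by positivity
  refine ⟨C, fun T F => ?_⟩
  have hε (ε : ℝ) (hε : 0 < ε) :
      ∑ i ∈ F, ‖inner ℂ (e i) ((T * X) (e i))‖ ≤ ‖T‖ * C + ε * (F.card * ‖T‖) := by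
    obtain ⟨U, hU1, hU⟩ := exists_eq_mul_abs_add X hε
    have hTU : ‖T * U‖ ≤ ‖T‖ :=
      (norm_mul_le T U).trans (mul_le_of_le_one_right (norm_nonneg _) hU1)
    have hterm (i : ι) : ‖inner ℂ (e i) ((T * X) (e i))‖ ≤
        ‖R ((T * U).adjoint (e i))‖ * ‖R (e i)‖ + ε * ‖T‖ := by
      have h1 : (T * X) (e i) = (T * U) (R (R (e i))) + (ε : ℂ) • (T * U) (e i) := by
        simp only [mul_apply_eq_comp, hU (e i), hRR, map_add, map_smul, hA]
      have h2 : inner ℂ (e i) ((T * U) (R (R (e i)))) =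
          inner ℂ (R ((T * U).adjoint (e i))) (R (e i)) := by
        rw [← ContinuousLinearMap.adjoint_inner_left, ← ContinuousLinearMap.adjoint_inner_left,
          hRsa.adjoint_eq]
      rw [h1, inner_add_right, h2, inner_smul_right]
      refine (norm_add_le _ _).trans (add_le_add (norm_inner_le_norm _ _) ?_)
      rw [norm_mul, Complex.norm_real, Real.norm_of_nonneg hε.le]
      gcongr
      calc ‖inner ℂ (e i) ((T * U) (e i))‖ ≤ ‖e i‖ * ‖(T * U) (e i)‖ := norm_inner_le_norm _ _
        _ ≤ 1 * (‖T * U‖ * 1) := by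
            have := (T * U).le_opNorm (e i)
            rw [he.norm_eq_one] at this ⊢
            gcongr
        _ ≤ ‖T‖ := by simpa using hTU
    have hsum1 := sum_norm_sq_comp_le b hRsa hs (T * U).adjoint he F
    have hsum2 := sum_norm_sq_comp_le b hRsa hs 1 he F
    have hone : ‖(1 : V →L[ℂ] V)‖ ^ 2 ≤ 1 := by
      have : ‖(1 : V →L[ℂ] V)‖ ≤ 1 := ContinuousLinearMap.norm_id_le
      exact pow_le_one₀ (norm_nonneg _) this
    calc ∑ i ∈ F, ‖inner ℂ (e i) ((T * X) (e i))‖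
        ≤ ∑ i ∈ F, (‖R ((T * U).adjoint (e i))‖ * ‖R (e i)‖ + ε * ‖T‖) :=
          Finset.sum_le_sum fun i _ => hterm i
      _ = ∑ i ∈ F, ‖R ((T * U).adjoint (e i))‖ * ‖R (e i)‖ + ε * (F.card * ‖T‖) := by
          rw [Finset.sum_add_distrib, Finset.sum_const, nsmul_eq_mul]
          ring
      _ ≤ √(‖T‖ ^ 2 * C) * √C + ε * (F.card * ‖T‖) := by
          gcongr
          refine (Real.sum_mul_le_sqrt_mul_sqrt _ _ _).trans ?_
          gcongr
          · refine hsum1.trans ?_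
            rw [LinearIsometryEquiv.norm_map]
            gcongr
          · exact hsum2.trans (mul_le_of_le_one_left hC0 hone)
      _ = ‖T‖ * C + ε * (F.card * ‖T‖) := by
          rw [Real.sqrt_mul (by positivity), Real.sqrt_sq (norm_nonneg _), mul_assoc,
            Real.mul_self_sqrt hC0]
  -- Letting `ε` tend to `0` removes the error term, the finite set `F` being fixed.
  refine le_of_forall_pos_le_add fun δ hδ => ?_
  have hK : 0 ≤ F.card * ‖T‖ := by positivity
  refine (hε (δ / (F.card * ‖T‖ + 1)) (by positivity)).trans ?_
  gcongr
  rw [div_mul_eq_mul_div, div_le_iff₀ (by positivity)]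
  nlinarith

/-- The series defining `trace (T * X)` converges for every bounded `T`, so that
`T ↦ trace (T * X)` is a genuine linear functional and not a junk value, and it is bounded. -/
theorem IsTraceClass.summable_and_exists_norm_trace_mul_le {X : V →L[ℂ] V} (hX : IsTraceClass X) :
    (∀ T : V →L[ℂ] V, Summable fun i => inner ℂ (hilbertBasis V i) ((T * X) (hilbertBasis V i))) ∧
    ∃ C : ℝ, ∀ T : V →L[ℂ] V, ‖trace (T * X)‖ ≤ ‖T‖ * C := by
  obtain ⟨C, hC⟩ := hX.exists_sum_norm_inner_le (hilbertBasis V).orthonormal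
  have hs (T : V →L[ℂ] V) :
      Summable fun i => ‖inner ℂ (hilbertBasis V i) ((T * X) (hilbertBasis V i))‖ :=
    summable_of_sum_le (fun _ => norm_nonneg _) (hC T)
  refine ⟨fun T => (hs T).of_norm, C, fun T => (norm_tsum_le_tsum_norm (hs T)).trans ?_⟩
  exact Real.tsum_le_of_sum_le (fun _ => norm_nonneg _) (hC T)

end TraceBound

/-! ### Compact operators as limits of combinations of projections -/

section SpanOfProjections

open InnerProductSpace

variable {H : Type*} [NormedAddCommGroup H] [InnerProductSpace ℂ H] [CompleteSpace H]

/-- By polarization, a rank one operator is a combination of four multiples of line projections. -/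
theorem rankOne_mem_span_isStarProjection (a b : H) :
    rankOne ℂ a b ∈ Submodule.span ℂ {p : H →L[ℂ] H | IsStarProjection p} := by
  have self (v : H) :
      rankOne ℂ v v ∈ Submodule.span ℂ {p : H →L[ℂ] H | IsStarProjection p} := by
    by_cases hv : v = 0
    · simp [hv]
    · obtain ⟨r, u, hu, rfl⟩ : ∃ (r : ℂ) (u : H), ‖u‖ = 1 ∧ v = r • u :=
        ⟨‖v‖, (‖v‖⁻¹ : ℂ) • v, norm_smul_inv_norm hv, by
          rw [smul_smul, mul_inv_cancel₀ (by simpa using hv), one_smul]⟩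
      simp only [map_smul, map_smulₛₗ, smul_apply]
      exact Submodule.smul_mem _ _ (Submodule.smul_mem _ _
        (Submodule.subset_span (isStarProjection_rankOne_self hu)))
  have polar : rankOne ℂ a b = (4⁻¹ : ℂ) • (rankOne ℂ (a + b) (a + b) - rankOne ℂ (a - b) (a - b)
      + Complex.I • rankOne ℂ (a + Complex.I • b) (a + Complex.I • b)
      - Complex.I • rankOne ℂ (a - Complex.I • b) (a - Complex.I • b)) := by
    simp only [map_add, map_sub, map_smul, map_smulₛₗ, add_apply, sub_apply, smul_apply,
      Complex.conj_I, smul_add, smul_sub, smul_smul, mul_neg, Complex.I_mul_I]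
    module
  rw [polar]
  exact Submodule.smul_mem _ _ (Submodule.sub_mem _ (Submodule.add_mem _
    (Submodule.sub_mem _ (self _) (self _)) (Submodule.smul_mem _ _ (self _)))
    (Submodule.smul_mem _ _ (self _)))

/-- A compact operator `x` is the norm limit of `P x`, with `P` the projection onto the span of a
finite net of the image of the unit ball. -/
theorem mem_closure_span_isStarProjection {x : H →L[ℂ] H} (hx : IsCompactOperator x) :
    x ∈ closure (Submodule.span ℂ {p : H →L[ℂ] H | IsStarProjection p} : Set (H →L[ℂ] H)) := by
  rw [Metric.mem_closure_iff]
  intro ε hε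
  have htb : TotallyBounded (x '' Metric.closedBall 0 1) :=
    (hx.isCompact_closure_image_closedBall (f := x.toLinearMap) 1).totallyBounded.subset
      subset_closure
  obtain ⟨t, ht, hcov⟩ := Metric.totallyBounded_iff.1 htb (ε / 2) (half_pos hε)
  set W := Submodule.span ℂ t
  have : FiniteDimensional ℂ W := FiniteDimensional.span_of_finite ℂ ht
  refine ⟨W.starProjection ∘L x, ?_, ?_⟩
  · rw [(stdOrthonormalBasis ℂ W).starProjection_eq_sum_rankOne, ContinuousLinearMap.finsetSum_comp]
    refine Submodule.sum_mem _ fun i _ => ?_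
    rw [rankOne_comp]
    exact rankOne_mem_span_isStarProjection _ _
  -- `P` minimizes the distance to its range, which contains the net.
  · rw [dist_eq_norm]
    refine lt_of_le_of_lt ?_ (half_lt_self hε)
    refine ContinuousLinearMap.opNorm_le_of_unit_norm (half_pos hε).le fun v hv => ?_
    have hmem : x v ∈ x '' Metric.closedBall 0 1 := ⟨v, by simp [hv], rfl⟩
    obtain ⟨c, hc, hcv⟩ := Set.mem_iUnion₂.1 (hcov hmem)
    rw [sub_apply, ContinuousLinearMap.comp_apply, W.starProjection_minimal]
    refine (ciInf_le ⟨0, ?_⟩ (⟨c, Submodule.subset_span hc⟩ : W)).trans ?_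
    · rintro _ ⟨y, rfl⟩
      exact norm_nonneg _
    · rw [← dist_eq_norm]
      exact (Metric.mem_ball.1 hcv).le

/-- A bounded bilinear form on `B(H)` is determined on compact operators by its values on
projections. -/
theorem eq_of_forall_proj_eq {D D' : (H →L[ℂ] H) →L[ℂ] (H →L[ℂ] H) →L[ℂ] ℂ}
    (h : ∀ p q : Proj H, D p.1 q.1 = D' p.1 q.1) {x y : H →L[ℂ] H}
    (hx : IsCompactOperator x) (hy : IsCompactOperator y) : D x y = D' x y := by
  have ext {f g : (H →L[ℂ] H) →L[ℂ] ℂ} (hfg : ∀ p : Proj H, f p.1 = g p.1) {z : H →L[ℂ] H}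
      (hz : IsCompactOperator z) : f z = g z := by
    have hspan : Set.EqOn f g (Submodule.span ℂ {p : H →L[ℂ] H | IsStarProjection p}) :=
      LinearMap.eqOn_span (f := f.toLinearMap) (g := g.toLinearMap) fun p hp => hfg ⟨p, hp⟩
    exact hspan.closure f.continuous g.continuous (mem_closure_span_isStarProjection hz)
  refine ext (f := D x) (g := D' x) (fun q => ?_) hy
  exact ext (f := D.flip q.1) (g := D'.flip q.1) (fun p => h p q) hx

end SpanOfProjections

/-! ### Operators on the Hilbert space tensor product -/

section Tensor

open InnerProductSpace

variable {H : Type*} [NormedAddCommGroup H] [InnerProductSpace ℂ H]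

/-- Bounded operators on the Hilbert space tensor product agree if they agree on simple tensors. -/
theorem clm_ext_tmul {S T : HilbertTensor H →L[ℂ] HilbertTensor H}
    (h : ∀ u v : H, S ((u ⊗ₜ[ℂ] v : H ⊗[ℂ] H) : HilbertTensor H) =
      T ((u ⊗ₜ[ℂ] v : H ⊗[ℂ] H) : HilbertTensor H)) : S = T := by
  ext z
  induction z using UniformSpace.Completion.induction_on with
  | hp => exact isClosed_eq S.continuous T.continuous
  | ih z =>
    induction z with
    | zero => rw [UniformSpace.Completion.coe_zero, map_zero, map_zero]
    | add s t hs ht => rw [UniformSpace.Completion.coe_add, map_add, map_add, hs, ht]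
    | tmul u v => exact h u v

theorem opTensor_rankOne (a b c d : H) :
    opTensor (rankOne ℂ a c) (rankOne ℂ b d) =
      rankOne ℂ ((a ⊗ₜ[ℂ] b : H ⊗[ℂ] H) : HilbertTensor H)
        ((c ⊗ₜ[ℂ] d : H ⊗[ℂ] H) : HilbertTensor H) :=
  clm_ext_tmul fun u v => by
    rw [opTensor_tmul, rankOne_apply, rankOne_apply, rankOne_apply,
      UniformSpace.Completion.inner_coe, TensorProduct.inner_tmul, TensorProduct.smul_tmul_smul,
      ← UniformSpace.Completion.coe_smul]

theorem norm_opTensor_le (x y : H →L[ℂ] H) : ‖opTensor x y‖ ≤ ‖x‖ * ‖y‖ := by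
  refine ContinuousLinearMap.opNorm_le_bound _ (by positivity) fun z => ?_
  induction z using UniformSpace.Completion.induction_on with
  | hp => exact isClosed_le (by fun_prop) (by fun_prop)
  | ih z =>
    rw [opTensor, ContinuousLinearMap.completion_apply_coe, UniformSpace.Completion.norm_coe,
      UniformSpace.Completion.norm_coe]
    exact (TensorProduct.mapL x y).le_of_opNorm_le (TensorProduct.norm_mapL_le x y) z

theorem opTensor_add_left (x x' y : H →L[ℂ] H) :
    opTensor (x + x') y = opTensor x y + opTensor x' y :=
  clm_ext_tmul fun u v => by
    rw [add_apply, opTensor_tmul, opTensor_tmul, opTensor_tmul, add_apply, TensorProduct.add_tmul,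
      UniformSpace.Completion.coe_add]

theorem opTensor_smul_left (c : ℂ) (x y : H →L[ℂ] H) :
    opTensor (c • x) y = c • opTensor x y :=
  clm_ext_tmul fun u v => by
    rw [smul_apply, opTensor_tmul, opTensor_tmul, smul_apply, ← TensorProduct.smul_tmul',
      UniformSpace.Completion.coe_smul]

theorem opTensor_add_right (x y y' : H →L[ℂ] H) :
    opTensor x (y + y') = opTensor x y + opTensor x y' :=
  clm_ext_tmul fun u v => by
    rw [add_apply, opTensor_tmul, opTensor_tmul, opTensor_tmul, add_apply, TensorProduct.tmul_add,
      UniformSpace.Completion.coe_add]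

theorem opTensor_smul_right (c : ℂ) (x y : H →L[ℂ] H) :
    opTensor x (c • y) = c • opTensor x y :=
  clm_ext_tmul fun u v => by
    rw [smul_apply, opTensor_tmul, opTensor_tmul, smul_apply, TensorProduct.tmul_smul,
      UniformSpace.Completion.coe_smul]

/-- A bounded functional on `B(H ⊗ H)` pulls back to a bounded bilinear form along
`(x, y) ↦ x ⊗ y`. -/
theorem exists_bilin_eq_comp_opTensor {φ : (HilbertTensor H →L[ℂ] HilbertTensor H) →ₗ[ℂ] ℂ}
    {C : ℝ} (hφ : ∀ T, ‖φ T‖ ≤ ‖T‖ * C) :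
    ∃ D : (H →L[ℂ] H) →L[ℂ] (H →L[ℂ] H) →L[ℂ] ℂ, ∀ x y, D x y = φ (opTensor x y) :=
  ⟨LinearMap.mkContinuous₂
    (LinearMap.mk₂ ℂ (fun x y => φ (opTensor x y))
      (fun x x' y => by rw [opTensor_add_left, map_add])
      (fun c x y => by rw [opTensor_smul_left, map_smul])
      (fun x y y' => by rw [opTensor_add_right, map_add])
      (fun c x y => by rw [opTensor_smul_right, map_smul]))
    |C| (fun x y =>
      calc ‖φ (opTensor x y)‖ ≤ ‖opTensor x y‖ * |C| :=
            (hφ _).trans (mul_le_mul_of_nonneg_left (le_abs_self C) (norm_nonneg (opTensor x y)))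
        _ ≤ ‖x‖ * ‖y‖ * |C| := mul_le_mul_of_nonneg_right (norm_opTensor_le x y) (abs_nonneg C)
        _ = |C| * ‖x‖ * ‖y‖ := by ring), fun _ _ => rfl⟩

theorem orthonormal_tmul_left {ι : Type*} {e : ι → H} (he : Orthonormal ℂ e) {ψ : H}
    (hψ : ‖ψ‖ = 1) :
    Orthonormal ℂ fun i => ((ψ ⊗ₜ[ℂ] e i : H ⊗[ℂ] H) : HilbertTensor H) := by
  refine ⟨fun i => ?_, fun i j hij => ?_⟩
  · rw [UniformSpace.Completion.norm_coe, TensorProduct.norm_tmul, hψ, he.norm_eq_one, one_mul]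
  · beta_reduce
    rw [UniformSpace.Completion.inner_coe, TensorProduct.inner_tmul, he.inner_eq_zero hij,
      mul_zero]

theorem orthonormal_tmul_right {ι : Type*} {e : ι → H} (he : Orthonormal ℂ e) {ψ : H}
    (hψ : ‖ψ‖ = 1) :
    Orthonormal ℂ fun i => ((e i ⊗ₜ[ℂ] ψ : H ⊗[ℂ] H) : HilbertTensor H) := by
  refine ⟨fun i => ?_, fun i j hij => ?_⟩
  · rw [UniformSpace.Completion.norm_coe, TensorProduct.norm_tmul, hψ, he.norm_eq_one, one_mul]
  · beta_reduce
    rw [UniformSpace.Completion.inner_coe, TensorProduct.inner_tmul, he.inner_eq_zero hij,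
      zero_mul]

theorem norm_sum_rankOne_le_one {V : Type*} [NormedAddCommGroup V] [InnerProductSpace ℂ V]
    {ι : Type*} {u v : ι → V} (hu : Orthonormal ℂ u) (hv : Orthonormal ℂ v) (F : Finset ι) :
    ‖∑ i ∈ F, rankOne ℂ (u i) (v i)‖ ≤ 1 := by
  refine ContinuousLinearMap.opNorm_le_bound _ zero_le_one fun z => ?_
  refine (sq_le_sq₀ (norm_nonneg _) (by positivity)).1 ?_
  rw [one_mul, sum_apply]
  simp only [rankOne_apply]
  have h : ‖∑ i ∈ F, inner ℂ (v i) z • u i‖ ^ 2 = ∑ i ∈ F, ‖inner ℂ (v i) z‖ ^ 2 := by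
    have h1 : inner ℂ (∑ i ∈ F, inner ℂ (v i) z • u i) (∑ i ∈ F, inner ℂ (v i) z • u i) =
        ((∑ i ∈ F, ‖inner ℂ (v i) z‖ ^ 2 : ℝ) : ℂ) := by
      rw [hu.inner_sum]
      push_cast
      exact Finset.sum_congr rfl fun i _ => Complex.conj_mul' _
    rw [inner_self_eq_norm_sq_to_K] at h1
    exact Complex.ofReal_injective (by simpa using h1)
  rw [h]
  exact hv.sum_inner_products_le z

theorem compactTensor_hom_ext {β β' : compactTensor H →ₗ[ℂ] ℂ}
    (h : ∀ (x y : H →L[ℂ] H) (hx : IsCompactOperator x) (hy : IsCompactOperator y),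
      β ⟨opTensor x y, opTensor_mem hx hy⟩ = β' ⟨opTensor x y, opTensor_mem hx hy⟩) : β = β' := by
  ext ⟨S, hS⟩
  induction hS using Submodule.span_induction with
  | mem T hT =>
    obtain ⟨x, y, hx, hy, rfl⟩ := hT
    exact h x y hx hy
  | zero => exact (map_zero β).trans (map_zero β').symm
  | add S T hS hT ihS ihT =>
    exact (map_add β ⟨S, hS⟩ ⟨T, hT⟩).trans ((congrArg₂ _ ihS ihT).trans
      (map_add β' ⟨S, hS⟩ ⟨T, hT⟩).symm)
  | smul c T hT ihT =>
    exact (map_smul β c ⟨T, hT⟩).trans ((congrArg _ ihT).trans (map_smul β' c ⟨T, hT⟩).symm)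

end Tensor

/-! ### Partial flips and unboundedness -/

section Flip

open InnerProductSpace

variable {H : Type*} [NormedAddCommGroup H] [InnerProductSpace ℂ H] [CompleteSpace H]

/-- The operator `y x` for `x = ⟨·, ψ⟩ e` and `y = ⟨·, e⟩ ψ` is the projection onto the line of
`ψ`. -/
theorem bilin_rankOne {ψ e : H} (hψ : ‖ψ‖ = 1) (he : ‖e‖ = 1) :
    bilin ψ (rankOne ℂ e ψ) (rankOne ℂ ψ e) = 1 := by
  rw [bilin_apply, adjoint_rankOne, rankOne_apply, inner_self_eq_one_of_norm_eq_one hψ, one_smul,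
    inner_self_eq_one_of_norm_eq_one he]

/-- The partial flip `ψ ⊗ e i ↦ e i ⊗ ψ`, over `n` members of an orthonormal basis, is a partial
isometry in `K(H) • K(H)` on which every functional agreeing with `B_ψ` on rank one operators takes
the value `n`. -/
theorem exists_large_of_eq_bilin (hH : ¬ FiniteDimensional ℂ H) {ψ : H} (hψ : ‖ψ‖ = 1) (n : ℕ) :
    ∃ S : compactTensor H, ‖(S : HilbertTensor H →L[ℂ] HilbertTensor H)‖ ≤ 1 ∧
      ∀ β : compactTensor H →ₗ[ℂ] ℂ,
        (∀ (a b c d : H), β ⟨opTensor (rankOne ℂ a b) (rankOne ℂ c d),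
          opTensor_mem (isCompactOperator_rankOne a b) (isCompactOperator_rankOne c d)⟩ =
            bilin ψ (rankOne ℂ a b) (rankOne ℂ c d)) → β S = n := by
  have hinf : Infinite (basisIndex H) := by
    by_contra hfin
    rw [not_infinite_iff_finite] at hfin
    have := Fintype.ofFinite (basisIndex H)
    exact hH (hilbertBasis H).toOrthonormalBasis.toBasis.finiteDimensional_of_finite
  obtain ⟨F, hF⟩ := Infinite.exists_subset_card_eq (basisIndex H) n
  have he := (hilbertBasis H).orthonormal
  set e := hilbertBasis H
  refine ⟨∑ i ∈ F, ⟨opTensor (rankOne ℂ (e i) ψ) (rankOne ℂ ψ (e i)),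
    opTensor_mem (isCompactOperator_rankOne _ _) (isCompactOperator_rankOne _ _)⟩, ?_,
    fun β hβ => ?_⟩
  · rw [Submodule.coe_sum]
    simp only [opTensor_rankOne]
    exact norm_sum_rankOne_le_one (orthonormal_tmul_right he hψ) (orthonormal_tmul_left he hψ) F
  · rw [map_sum]
    simp only [hβ, bilin_rankOne hψ (he.norm_eq_one _)]
    simp [hF]

theorem not_isBoundedFunctional (hH : ¬ FiniteDimensional ℂ H) {ψ : H} (hψ : ‖ψ‖ = 1)
    {β : compactTensor H →ₗ[ℂ] ℂ}
    (hβ : ∀ (a b c d : H), β ⟨opTensor (rankOne ℂ a b) (rankOne ℂ c d),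
      opTensor_mem (isCompactOperator_rankOne a b) (isCompactOperator_rankOne c d)⟩ =
        bilin ψ (rankOne ℂ a b) (rankOne ℂ c d)) :
    ¬ IsBoundedFunctional β := by
  rintro ⟨C, hC⟩
  obtain ⟨n, hn⟩ := exists_nat_gt |C|
  obtain ⟨S, hS1, hS⟩ := exists_large_of_eq_bilin hH hψ n
  have h := hC S
  rw [hS β hβ, Complex.norm_natCast] at h
  have h2 : C * ‖(S : HilbertTensor H →L[ℂ] HilbertTensor H)‖ ≤ |C| * 1 :=
    mul_le_mul (le_abs_self C) hS1 (norm_nonneg S.1) (abs_nonneg C)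
  linarith

theorem bilin_eq_vectorFunctional (ψ : H) (p q : Proj H) :
    bilin ψ p.1 q.1 = vectorFunctional ψ p q := by
  rw [bilin_apply, q.2.isSelfAdjoint.adjoint_eq, vectorFunctional]

/-- A trace class operator `X` representing `d_ψ` would give a bounded functional `S ↦ tr (S X)` on
`K(H) • K(H)` that agrees with `B_ψ` on rank one operators. -/
theorem not_isILSRepresentable (hH : ¬ FiniteDimensional ℂ H) {ψ : H} (hψ : ‖ψ‖ = 1) :
    ¬ IsILSRepresentable (vectorFunctional ψ) := by
  rintro ⟨X, hX, hd⟩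
  obtain ⟨hs, C, hC⟩ := hX.summable_and_exists_norm_trace_mul_le
  let φ : (HilbertTensor H →L[ℂ] HilbertTensor H) →ₗ[ℂ] ℂ :=
    { toFun := fun T => trace (T * X)
      map_add' := fun S T => by
        simp only [trace]
        rw [← (hs S).tsum_add (hs T)]
        simp only [add_mul, add_apply, inner_add_right]
      map_smul' := fun c T => by
        simp only [trace, RingHom.id_apply, smul_eq_mul]
        rw [← tsum_mul_left]
        simp only [smul_mul_assoc, smul_apply, inner_smul_right] }
  obtain ⟨D, hD⟩ := exists_bilin_eq_comp_opTensor (φ := φ) hC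
  have hDp (p q : Proj H) : D p.1 q.1 = bilin ψ p.1 q.1 := by
    rw [bilin_eq_vectorFunctional, hD]
    exact (hd p q).symm
  refine not_isBoundedFunctional hH hψ (β := φ ∘ₗ (compactTensor H).subtype)
    (fun a b c d => ?_) ⟨C, fun S => (hC S).trans_eq (mul_comm _ _)⟩
  rw [← eq_of_forall_proj_eq hDp (isCompactOperator_rankOne a b) (isCompactOperator_rankOne c d),
    hD]
  rfl

end Flip

/-! ### The functional associated with `d_ψ` -/

section Contraction

open InnerProductSpace

variable {H : Type*} [NormedAddCommGroup H] [InnerProductSpace ℂ H] [CompleteSpace H]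

/-- The expansion of `⟨x ψ, y* ψ⟩` in an orthonormal basis `e` depends on `x` and `y` only through
the operator `x ⊗ y`, applied to the vectors `ψ ⊗ e k`. -/
theorem hasSum_inner_opTensor (ψ : H) (x y : H →L[ℂ] H) :
    HasSum (fun k => inner ℂ ((hilbertBasis H k ⊗ₜ[ℂ] ψ : H ⊗[ℂ] H) : HilbertTensor H)
      (opTensor x y ((ψ ⊗ₜ[ℂ] hilbertBasis H k : H ⊗[ℂ] H) : HilbertTensor H)))
      (bilin ψ x y) := by
  rw [bilin_apply]
  convert! (hilbertBasis H).hasSum_inner_mul_inner (y.adjoint ψ) (x ψ) using 1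
  ext k
  rw [opTensor_tmul, UniformSpace.Completion.inner_coe, TensorProduct.inner_tmul,
    ContinuousLinearMap.adjoint_inner_left, mul_comm]

/-- The sum that defines `contraction ψ` converges on all of `K(H) • K(H)`, since the operators for
which it converges form a subspace containing every `x ⊗ y`. -/
theorem summable_inner_compactTensor (ψ : H) (S : compactTensor H) :
    Summable fun k => inner ℂ ((hilbertBasis H k ⊗ₜ[ℂ] ψ : H ⊗[ℂ] H) : HilbertTensor H)
      (S.1 ((ψ ⊗ₜ[ℂ] hilbertBasis H k : H ⊗[ℂ] H) : HilbertTensor H)) := by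
  obtain ⟨S, hS⟩ := S
  induction hS using Submodule.span_induction with
  | mem T hT =>
    obtain ⟨x, y, -, -, rfl⟩ := hT
    exact (hasSum_inner_opTensor ψ x y).summable
  | zero => simp
  | add S T _ _ hS hT => simpa only [add_apply, inner_add_right] using hS.add hT
  | smul c T _ hT => simpa only [smul_apply, inner_smul_right] using hT.mul_left c

/-- The functional `S ↦ ∑ ⟨S (ψ ⊗ e k), e k ⊗ ψ⟩` on `K(H) • K(H)`, over the orthonormal basis
`e = hilbertBasis H`. Giving it by a formula in the operator `S` makes it well defined without
reference to a decomposition of `S` as a sum of operators `x ⊗ y`. -/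
noncomputable def contraction (ψ : H) : compactTensor H →ₗ[ℂ] ℂ where
  toFun S := ∑' k, inner ℂ ((hilbertBasis H k ⊗ₜ[ℂ] ψ : H ⊗[ℂ] H) : HilbertTensor H)
      (S.1 ((ψ ⊗ₜ[ℂ] hilbertBasis H k : H ⊗[ℂ] H) : HilbertTensor H))
  map_add' S T := by
    rw [← (summable_inner_compactTensor ψ S).tsum_add (summable_inner_compactTensor ψ T)]
    simp only [Submodule.coe_add, add_apply, inner_add_right]
  map_smul' c S := by
    rw [RingHom.id_apply, smul_eq_mul, ← tsum_mul_left]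
    simp only [Submodule.coe_smul, smul_apply, inner_smul_right]

theorem contraction_opTensor (ψ : H) {x y : H →L[ℂ] H} (hx : IsCompactOperator x)
    (hy : IsCompactOperator y) :
    contraction ψ ⟨opTensor x y, opTensor_mem hx hy⟩ = bilin ψ x y :=
  (hasSum_inner_opTensor ψ x y).tsum_eq

/-- On the operator `p_ξ` the contraction is `∑ ⟨ξ, e k ⊗ ψ⟩ ⟨ψ ⊗ e k, ξ⟩`, which pairs the Fourier
coefficients of `ξ` in two orthonormal families; Cauchy–Schwarz and Bessel bound it. -/
theorem norm_contraction_lineProj_le {ψ : H} (hψ : ‖ψ‖ = 1) (ξ : H ⊗[ℂ] H) :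
    ‖contraction ψ ⟨lineProj ξ, lineProj_mem ξ⟩‖ ≤ ‖ξ‖ ^ 2 := by
  have he := (hilbertBasis H).orthonormal
  have hl := orthonormal_tmul_left he hψ
  have hr := orthonormal_tmul_right he hψ
  refine le_of_tendsto
    (summable_inner_compactTensor ψ ⟨lineProj ξ, lineProj_mem ξ⟩).hasSum.norm
    (Filter.Eventually.of_forall fun F => (norm_sum_le _ _).trans ?_)
  simp only [lineProj_apply, inner_smul_right, norm_mul]
  refine (Real.sum_mul_le_sqrt_mul_sqrt _ _ _).trans ?_
  have h1 := hl.sum_inner_products_le (ξ : HilbertTensor H) (s := F)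
  have h2 := hr.sum_inner_products_le (ξ : HilbertTensor H) (s := F)
  rw [UniformSpace.Completion.norm_coe] at h1 h2
  simp only [norm_inner_symm _ (ξ : HilbertTensor H)] at h1 h2 ⊢
  calc _ ≤ √(‖ξ‖ ^ 2) * √(‖ξ‖ ^ 2) := by gcongr
    _ = ‖ξ‖ ^ 2 := Real.mul_self_sqrt (by positivity)

end Contraction

/-! ### The decoherence functional `d_ψ` -/

section VectorFunctional

variable {H : Type*} [NormedAddCommGroup H] [InnerProductSpace ℂ H] [CompleteSpace H]

theorem isDecoherenceFunctional_vectorFunctional {ψ : H} (hψ : ‖ψ‖ = 1) :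
    IsDecoherenceFunctional (vectorFunctional ψ) where
  hermitian p q := (inner_conj_symm _ _).symm
  nonneg p := ⟨inner_self_nonneg (𝕜 := ℂ), inner_self_im (𝕜 := ℂ) _⟩
  normalised := inner_self_eq_one_of_norm_eq_one hψ
  orthoadditive p₁ p₂ p q _ h := by
    rw [vectorFunctional, h, add_apply, inner_add_right, vectorFunctional, vectorFunctional]

theorem isBounded_vectorFunctional (ψ : H) : IsBounded (vectorFunctional ψ) := by
  have hle (p : Proj H) : ‖p.1 ψ‖ ≤ ‖ψ‖ := by
    have h : ‖p.1‖ ≤ 1 := p.2.norm_le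
    exact (p.1.le_of_opNorm_le h ψ).trans_eq (one_mul _)
  exact ⟨‖ψ‖ * ‖ψ‖, fun p q => (norm_inner_le_norm _ _).trans (by gcongr <;> exact hle _)⟩

theorem isCountablyAdditive_vectorFunctional (ψ : H) :
    IsCountablyAdditive (vectorFunctional ψ) :=
  fun _ _ q _ hs => (hs ψ).mapL (innerSL ℂ (q.1 ψ))

theorem isAssociated_contraction (ψ : H) :
    IsAssociated (vectorFunctional ψ) (contraction ψ) :=
  ⟨bilin ψ, bilin_eq_vectorFunctional ψ, fun _ _ hx hy => contraction_opTensor ψ hx hy⟩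

/-- Uniqueness of the associated functional: any bounded bilinear extension of `d_ψ` agrees with
`B_ψ` on compact operators. -/
theorem isAssociated_iff (ψ : H) (β : compactTensor H →ₗ[ℂ] ℂ) :
    IsAssociated (vectorFunctional ψ) β ↔ β = contraction ψ := by
  refine ⟨?_, fun h => h ▸ isAssociated_contraction ψ⟩
  rintro ⟨D, hD, hβ⟩
  refine compactTensor_hom_ext fun x y hx hy => ?_
  rw [hβ x y hx hy, contraction_opTensor ψ hx hy]
  exact eq_of_forall_proj_eq
    (fun p q => (hD p q).trans (bilin_eq_vectorFunctional ψ p q).symm) hx hy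

end VectorFunctional

end DecoherenceFunctional

theorem mainTheorem5 {H : Type*} [NormedAddCommGroup H] [InnerProductSpace ℂ H] [CompleteSpace H]
    [TopologicalSpace.SeparableSpace H] (hH : ¬ FiniteDimensional ℂ H) (ψ : H) (hψ : ‖ψ‖ = 1) :
    DecoherenceFunctional.IsDecoherenceFunctional (DecoherenceFunctional.vectorFunctional ψ) ∧
    DecoherenceFunctional.IsBounded (DecoherenceFunctional.vectorFunctional ψ) ∧
    DecoherenceFunctional.IsCountablyAdditive (DecoherenceFunctional.vectorFunctional ψ) ∧
    (∀ p q : DecoherenceFunctional.Proj H,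
      DecoherenceFunctional.bilin ψ p.1 q.1 = DecoherenceFunctional.vectorFunctional ψ p q) ∧
    ¬ DecoherenceFunctional.IsILSRepresentable (DecoherenceFunctional.vectorFunctional ψ) ∧
    (∃ β : DecoherenceFunctional.compactTensor H →ₗ[ℂ] ℂ,
      (∀ (x y : H →L[ℂ] H) (hx : IsCompactOperator x) (hy : IsCompactOperator y),
        β ⟨DecoherenceFunctional.opTensor x y, DecoherenceFunctional.opTensor_mem hx hy⟩ =
          DecoherenceFunctional.bilin ψ x y) ∧
      (∀ β' : DecoherenceFunctional.compactTensor H →ₗ[ℂ] ℂ,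
        DecoherenceFunctional.IsAssociated (DecoherenceFunctional.vectorFunctional ψ) β' ↔
          β' = β) ∧
      ¬ DecoherenceFunctional.IsBoundedFunctional β) ∧
    DecoherenceFunctional.IsTraciallyBounded (DecoherenceFunctional.vectorFunctional ψ) := by
  open DecoherenceFunctional in
  exact ⟨isDecoherenceFunctional_vectorFunctional hψ, isBounded_vectorFunctional ψ,
    isCountablyAdditive_vectorFunctional ψ, bilin_eq_vectorFunctional ψ,
    not_isILSRepresentable hH hψ,
    ⟨contraction ψ, fun _ _ hx hy => contraction_opTensor ψ hx hy, isAssociated_iff ψ,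
      not_isBoundedFunctional hH hψ fun a b c d => contraction_opTensor ψ
        (isCompactOperator_rankOne a b) (isCompactOperator_rankOne c d)⟩,
    isBounded_vectorFunctional ψ, contraction ψ, isAssociated_contraction ψ, 1, fun ξ hξ =>
      (norm_contraction_lineProj_le hψ ξ).trans_eq (by rw [hξ, one_pow])⟩
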